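/- **Theorem 2.3 (commuting gradient flows).** Let $M$ be a compact smooth Riemannian manifold without boundary, of dimension $n$ (not necessarily connected). For a smooth function $f:M\to\mathbb R$ let $\varphi_f^t$ be its gradient flow, i.e. the flow of $\dot x=\operatorname{grad} f(x)$. Call $f$ a Morse function if all its critical points are nondegenerate. The cell decomposition of $M$ determined by a Morse function $f$ is the collection of the cells $$C_f(p)=\{x\in M:\ \lim_{t\to+\infty}\varphi_f^t(x)=p\},$$ one for each critical point $p$ of $f$. Let $T$ be a connected topological space and let $(f_\tau)_{\tau\in T}$ be a family of smooth Morse functions on $M$ depending continuously on $\tau$ in the $C^2$ topology (in every chart, all $x$-derivatives of $f_\tau(x)$ of order at most $2$ are jointly continuous in $(\tau,x)$). Suppose that the gradient flows of the functions of the family commute with each other: $\varphi_{f_\sigma}^s\circ\varphi_{f_\tau}^t=\varphi_{f_\tau}^t\circ\varphi_{f_\sigma}^s$ for all $\sigma,\tau\in T$ and $s,t\in\mathbb R$. Then any two functions of the family determine the same cell decomposition of $M$: $\{C_{f_\sigma}(p): \operatorname{grad}f_\sigma(p)=0\}=\{C_{f_\tau}(p): \operatorname{grad}f_\tau(p)=0\}$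 for all $\sigma,\tau\in T$. -/

import Mathlib

open Set Filter Topology Bundle
open scoped Manifold ContDiff

noncomputable section

namespace GradientCells

/-- The set of critical points of a function `f : M → ℝ`. -/
def criticalSet (n : ℕ) {M : Type*} [TopologicalSpace M]
    [ChartedSpace (EuclideanSpace ℝ (Fin n)) M] (f : M → ℝ) : Set M :=
  {p | mfderiv (𝓡 n) 𝓘(ℝ, ℝ) f p = 0}

/-- The function `f` read in the preferred chart at `p`. -/
def localRep (n : ℕ) {M : Type*} [TopologicalSpace M]
    [ChartedSpace (EuclideanSpace ℝ (Fin n)) M] (f : M → ℝ) (p : M) :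
    EuclideanSpace ℝ (Fin n) → ℝ :=
  f ∘ (extChartAt (𝓡 n) p).symm

/-- The Hessian of `f` at `p` in the preferred chart at `p`. At a critical point its
nondegeneracy does not depend on the chart. -/
def hessianAt (n : ℕ) {M : Type*} [TopologicalSpace M]
    [ChartedSpace (EuclideanSpace ℝ (Fin n)) M] (f : M → ℝ) (p : M) :
    EuclideanSpace ℝ (Fin n) →L[ℝ] EuclideanSpace ℝ (Fin n) →L[ℝ] ℝ :=
  fderiv ℝ (fderiv ℝ (localRep n f p)) (extChartAt (𝓡 n) p p)

/-- A Morse function: a smooth function all of whose critical points are nondegenerate. -/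
structure IsMorse (n : ℕ) {M : Type*} [TopologicalSpace M]
    [ChartedSpace (EuclideanSpace ℝ (Fin n)) M] (f : M → ℝ) : Prop where
  smooth : ContMDiff (𝓡 n) 𝓘(ℝ, ℝ) ∞ f
  nondegenerate : ∀ p ∈ criticalSet n f, ∀ v, (∀ w, hessianAt n f p v w = 0) → v = 0

/-- A family `F t` of functions on `M` depends continuously on the parameter `t` in the
`C²` sense: in every chart, the `x`-derivatives of order at most two are jointly continuous in
`(t, x)`. As the domain of a chart is locally compact, this says that `t ↦ F t` is continuous
for the (compact-open) `C²` topology on functions; in particular every family that is continuous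
for the `C^∞` topology is of this kind. -/
def IsC2Family (n : ℕ) {M : Type*} [TopologicalSpace M]
    [ChartedSpace (EuclideanSpace ℝ (Fin n)) M] {T : Type*} [TopologicalSpace T]
    (F : T → M → ℝ) : Prop :=
  ∀ p : M, ∀ k : ℕ, k ≤ 2 →
    ContinuousOn (fun z : T × EuclideanSpace ℝ (Fin n) ↦
        iteratedFDeriv ℝ k (localRep n (F z.1) p) z.2)
      (univ ×ˢ (extChartAt (𝓡 n) p).target)

/-- The gradient of `f` at `x`: the Riesz representative of `df(x)` with respect to the
Riemannian inner product of the tangent space at `x`. -/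
def grad (n : ℕ) {M : Type*} [TopologicalSpace M]
    [ChartedSpace (EuclideanSpace ℝ (Fin n)) M]
    [RiemannianBundle (fun x : M ↦ TangentSpace (𝓡 n) x)] (f : M → ℝ) (x : M) :
    TangentSpace (𝓡 n) x :=
  haveI : FiniteDimensional ℝ (TangentSpace (𝓡 n) x) :=
    inferInstanceAs (FiniteDimensional ℝ (EuclideanSpace ℝ (Fin n)))
  haveI : CompleteSpace (TangentSpace (𝓡 n) x) :=
    FiniteDimensional.complete ℝ (TangentSpace (𝓡 n) x)
  (InnerProductSpace.toDual ℝ (TangentSpace (𝓡 n) x)).symm (mfderiv (𝓡 n) 𝓘(ℝ, ℝ) f x)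

theorem inner_grad {n : ℕ} {M : Type*} [TopologicalSpace M]
    [ChartedSpace (EuclideanSpace ℝ (Fin n)) M]
    [RiemannianBundle (fun x : M ↦ TangentSpace (𝓡 n) x)] (f : M → ℝ) (x : M) (v : TangentSpace (𝓡 n) x) :
    inner ℝ (grad n f x) v = mfderiv (𝓡 n) 𝓘(ℝ, ℝ) f x v := by
  have : FiniteDimensional ℝ (TangentSpace (𝓡 n) x) :=
    inferInstanceAs (FiniteDimensional ℝ (EuclideanSpace ℝ (Fin n)))
  have : CompleteSpace (TangentSpace (𝓡 n) x) :=
    FiniteDimensional.complete ℝ (TangentSpace (𝓡 n) x)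
  exact InnerProductSpace.toDual_symm_apply (𝕜 := ℝ) (E := TangentSpace (𝓡 n) x)

open Classical in
/-- The gradient flow of `f`: `gradFlow n f t x` is the value at time `t` of the solution
`γ : ℝ → M` of `γ' = grad f (γ)`, `γ 0 = x`. For a smooth function on a compact manifold the
solution exists for all times and is unique; the value `x` in the other case is a dummy. -/
def gradFlow (n : ℕ) {M : Type*} [TopologicalSpace M]
    [ChartedSpace (EuclideanSpace ℝ (Fin n)) M]
    [RiemannianBundle (fun x : M ↦ TangentSpace (𝓡 n) x)] (f : M → ℝ) (t : ℝ) (x : M) : M :=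
  if h : ∃ γ : ℝ → M, γ 0 = x ∧ IsMIntegralCurve γ (grad n f) then h.choose t else x

/-- The gradient flows of `f` and `g` commute. -/
def GradFlowsCommute (n : ℕ) {M : Type*} [TopologicalSpace M]
    [ChartedSpace (EuclideanSpace ℝ (Fin n)) M]
    [RiemannianBundle (fun x : M ↦ TangentSpace (𝓡 n) x)] (f g : M → ℝ) : Prop :=
  ∀ (s t : ℝ) (x : M), gradFlow n f s (gradFlow n g t x) = gradFlow n g t (gradFlow n f s x)

/-- The cell of the critical point `p`: all points whose gradient trajectory tends to `p` as
`t → +∞`. -/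
def cell (n : ℕ) {M : Type*} [TopologicalSpace M]
    [ChartedSpace (EuclideanSpace ℝ (Fin n)) M]
    [RiemannianBundle (fun x : M ↦ TangentSpace (𝓡 n) x)] (f : M → ℝ) (p : M) : Set M :=
  {x | Tendsto (fun t : ℝ ↦ gradFlow n f t x) atTop (𝓝 p)}

/-- The cell decomposition of `M` determined by `f`: the collection of the cells of the critical
points of `f`. -/
def cellDecomposition (n : ℕ) {M : Type*} [TopologicalSpace M]
    [ChartedSpace (EuclideanSpace ℝ (Fin n)) M]
    [RiemannianBundle (fun x : M ↦ TangentSpace (𝓡 n) x)] (f : M → ℝ) : Set (Set M) :=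
  cell n f '' criticalSet n f

end GradientCells

end

/-! The cells turn out to be locally constant in the parameter, so connectedness of `T` finishes the
proof.

Commutation alone makes all critical sets equal: the flow of `g` permutes the rest points of `f`,
these are finite in number, and a continuous orbit inside a finite set is constant
(`criticalSet_subset_of_commute`).

Fix `s`. Near a common critical point, nondegeneracy makes `d(F s)` comparable to the distance from
that point, while `C²` continuity makes `d(F t) - d(F s)` small relative to that distance; away from
critical points plain continuity is enough. By compactness of `M`, for all `t` near `s` the inner
product of the two gradients is everywhere at least `‖grad (F s)‖² / 2`
(`eventually_inner_grad_ge`). Hence `F s` is a Lyapunov function for both flows.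

Now let `φ`, `ψ` be commuting flows with Lyapunov function `f` and finite rest set `C`, and let `φ a
x → p`. Then `φ a (ψ b x) → p` for every `b`. Since `f (ψ b x)` increases to `f p`, for large `b`
the whole curve `φ a (ψ b x)`, `a ≥ 0`, lies near `C`. It is connected and ends near `p`, so it also
starts near `p`: thus `ψ b x → p` (`tendsto_of_commuting`). -/

noncomputable section

namespace GradientCells

/-! ### Commuting flows with a common Lyapunov function -/

/-- Two commuting flows on a compact space with a common Lyapunov function and the same finite set
of rest points have the same cells. -/
theorem tendsto_of_commuting {M : Type*} [TopologicalSpace M] [T2Space M] [CompactSpace M]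
    {φ ψ : ℝ → M → M} {f : M → ℝ} {C : Set M}
    (hφ : ∀ t, Continuous (φ t)) (hφ' : ∀ x, Continuous fun t ↦ φ t x)
    (hψ : ∀ t, Continuous (ψ t))
    (hφ0 : ∀ x, φ 0 x = x) (hψ0 : ∀ x, ψ 0 x = x)
    (hψadd : ∀ s t x, ψ (s + t) x = ψ s (ψ t x))
    (hcomm : ∀ s t x, φ s (ψ t x) = ψ t (φ s x))
    (hf : Continuous f)
    (hfφ : ∀ x, Monotone fun t ↦ f (φ t x)) (hfψ : ∀ x, Monotone fun t ↦ f (ψ t x))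
    (hψC : ∀ x, f (ψ 1 x) = f x → x ∈ C)
    (hC : C.Finite) (hCφ : ∀ x ∈ C, ∀ t, φ t x = x) (hCψ : ∀ x ∈ C, ∀ t, ψ t x = x)
    {x p : M} (hp : p ∈ C) (hx : Tendsto (fun t ↦ φ t x) atTop (𝓝 p)) :
    Tendsto (fun t ↦ ψ t x) atTop (𝓝 p) := by
  have monoa : ∀ b, Monotone fun a ↦ f (φ a (ψ b x)) := fun b ↦ hfφ _
  have monob : ∀ a, Monotone fun b ↦ f (φ a (ψ b x)) := fun a ↦ by
    simpa only [hcomm] using hfψ (φ a x)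
  have lima : ∀ b, Tendsto (fun a ↦ φ a (ψ b x)) atTop (𝓝 p) := fun b ↦ by
    have := ((hψ b).tendsto p).comp hx
    rw [hCψ p hp] at this
    simpa only [hcomm, Function.comp_def] using this
  have le_p : ∀ a b, f (φ a (ψ b x)) ≤ f p := fun a b ↦
    (monoa b).ge_of_tendsto ((hf.tendsto p).comp (lima b)) a
  have tfa : Tendsto (fun a ↦ f (φ a x)) atTop (𝓝 (f p)) := (hf.tendsto p).comp hx
  -- the values of `f` along the orbit of `ψ` have the same supremum
  have tfb : Tendsto (fun b ↦ f (ψ b x)) atTop (𝓝 (f p)) := by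
    obtain ⟨S, hS⟩ : ∃ S, Tendsto (fun b ↦ f (ψ b x)) atTop (𝓝 S) :=
      ⟨_, tendsto_atTop_ciSup (hfψ x) ⟨f p, by
        rintro _ ⟨b, rfl⟩
        simpa [hφ0] using le_p 0 b⟩⟩
    -- A limit point `q` of the `ψ`-orbit satisfies `f q = S = f (ψ 1 q)`, hence is a rest point.
    obtain ⟨𝒰, h𝒰⟩ := exists_ultrafilter_le (atTop : Filter ℝ)
    obtain ⟨q, hq⟩ : ∃ q, Tendsto (fun b ↦ ψ b x) 𝒰 (𝓝 q) := by
      obtain ⟨q, -, hq⟩ := isCompact_univ.ultrafilter_le_nhds (𝒰.map fun b ↦ ψ b x) (by simp)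
      exact ⟨q, hq⟩
    have hqS : f q = S := tendsto_nhds_unique ((hf.tendsto q).comp hq) (hS.mono_left h𝒰)
    have hqC : q ∈ C := by
      refine hψC q ?_
      rw [hqS]
      refine tendsto_nhds_unique (((hf.comp (hψ 1)).tendsto q).comp hq) ?_
      refine ((hS.comp (tendsto_atTop_add_const_left _ (1 : ℝ) tendsto_id)).mono_left h𝒰).congr ?_
      intro b
      simp [hψadd]
    -- As `φ a` fixes `q`, the values `f (φ a (ψ b x))` still tend to `S`, and they dominate `f (φ a
    -- x)` once `b ≥ 0`.
    have hle : ∀ a, f (φ a x) ≤ S := fun a ↦ by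
      have h1 : Tendsto (fun b ↦ f (φ a (ψ b x))) 𝒰 (𝓝 S) := by
        have := ((hf.comp (hφ a)).tendsto q).comp hq
        simpa [Function.comp_def, hCφ q hqC, hqS] using this
      refine ge_of_tendsto h1 ?_
      filter_upwards [h𝒰 (eventually_ge_atTop (0 : ℝ))] with b hb
      simpa [hψ0] using monob a hb
    have h1 : f p ≤ S := le_of_tendsto' tfa hle
    have h2 : S ≤ f p := le_of_tendsto' hS fun b ↦ by simpa [hφ0] using le_p 0 b
    rwa [le_antisymm h1 h2]
  -- Approach to `C` as `b → ∞`, uniformly in `a ≥ 0`: `f` is squeezed between `f (ψ b x)` and `f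
  -- p`, so every limit point has the same value of `f` as its image under `ψ 1`.
  have key : Tendsto (fun z : ℝ × ℝ ↦ φ z.2 (ψ z.1 x)) (atTop ×ˢ 𝓟 (Ici 0)) (𝓝ˢ C) := by
    rw [tendsto_iff_ultrafilter]
    intro 𝒰 h
    obtain ⟨y, -, hy⟩ := isCompact_univ.ultrafilter_le_nhds
      (𝒰.map fun z : ℝ × ℝ ↦ φ z.2 (ψ z.1 x)) (by simp)
    change Tendsto (fun z : ℝ × ℝ ↦ φ z.2 (ψ z.1 x)) 𝒰 (𝓝 y) at hy
    suffices y ∈ C from Tendsto.mono_right hy (nhds_le_nhdsSet this)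
    have h1 : Tendsto (fun z : ℝ × ℝ ↦ z.1) 𝒰 atTop := tendsto_fst.mono_left h
    have h2 : ∀ᶠ z in (𝒰 : Filter (ℝ × ℝ)), (0 : ℝ) ≤ z.2 :=
      h (tendsto_snd.eventually (mem_principal_self (Ici (0 : ℝ))))
    have h3 : ∀ {c : ℝ × ℝ → ℝ}, Tendsto c 𝒰 atTop →
        Tendsto (fun z : ℝ × ℝ ↦ f (φ z.2 (ψ (c z) x))) 𝒰 (𝓝 (f p)) := fun hc ↦
      tendsto_of_tendsto_of_tendsto_of_le_of_le' (tfb.comp hc) tendsto_const_nhds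
        (h2.mono fun z hz ↦ by simpa [hφ0] using monoa _ hz) (Eventually.of_forall fun z ↦ le_p _ _)
    refine hψC y ?_
    rw [tendsto_nhds_unique ((hf.tendsto y).comp hy) (h3 h1)]
    refine tendsto_nhds_unique (((hf.comp (hψ 1)).tendsto y).comp hy) ?_
    refine (h3 (tendsto_atTop_add_const_left _ (1 : ℝ) h1)).congr fun z ↦ ?_
    simp [hψadd, hcomm]
  -- separate `p` from the other rest points
  obtain ⟨U, W, hU, hW, hpU, hCW, hUW⟩ : SeparatedNhds {p} (C \ {p}) :=
    SeparatedNhds.of_isCompact_isCompact isCompact_singleton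
      (hC.subset sdiff_subset).isCompact (by simp)
  rw [singleton_subset_iff] at hpU
  rw [tendsto_nhds]
  intro V hV hpV
  have hmem : (U ∩ V) ∪ W ∈ 𝓝ˢ C := by
    refine ((hU.inter hV).union hW).mem_nhdsSet.2 fun c hc ↦ ?_
    by_cases h : c = p
    · exact Or.inl (h ▸ ⟨hpU, hpV⟩)
    · exact Or.inr (hCW ⟨hc, h⟩)
  filter_upwards [eventually_prod_principal_iff.1 (key hmem)] with b hb
  have hconn : IsPreconnected ((fun a ↦ φ a (ψ b x)) '' Ici 0) :=
    isPreconnected_Ici.image _ (hφ' _).continuousOn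
  have hsub := hconn.subset_left_of_subset_union (hU.inter hV) hW
    (hUW.mono_left inter_subset_left) (image_subset_iff.2 hb) (by
      obtain ⟨a, ha, ha'⟩ := ((lima b).eventually ((hU.inter hV).mem_nhds ⟨hpU, hpV⟩) |>.and
        (eventually_ge_atTop 0)).exists
      exact ⟨_, mem_image_of_mem _ ha', ha⟩)
  have := hsub (mem_image_of_mem _ (mem_Ici.2 le_rfl))
  rw [hφ0] at this
  exact this.2

/-! ### The gradient in charts and its regularity -/

section Gradient

variable {n : ℕ} {M : Type*} [TopologicalSpace M] [ChartedSpace (EuclideanSpace ℝ (Fin n)) M]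

theorem contDiffOn_localRep [IsManifold (𝓡 n) ∞ M] {f : M → ℝ}
    (hf : ContMDiff (𝓡 n) 𝓘(ℝ, ℝ) ∞ f) (y : M) :
    ContDiffOn ℝ ∞ (localRep n f y) (extChartAt (𝓡 n) y).target :=
  contMDiffOn_iff_contDiffOn.1 (hf.comp_contMDiffOn (contMDiffOn_extChartAt_symm y))

theorem contDiffAt_localRep [IsManifold (𝓡 n) ∞ M] {f : M → ℝ}
    (hf : ContMDiff (𝓡 n) 𝓘(ℝ, ℝ) ∞ f) {y : M} {z : EuclideanSpace ℝ (Fin n)}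
    (hz : z ∈ (extChartAt (𝓡 n) y).target) : ContDiffAt ℝ ∞ (localRep n f y) z :=
  (contDiffOn_localRep hf y).contDiffAt ((isOpen_extChartAt_target y).mem_nhds hz)

/-- Chain rule: the trivialization of the tangent bundle at `y` is the derivative of the chart at
`y`. -/
theorem mfderiv_apply_eq_fderiv_localRep [IsManifold (𝓡 n) ∞ M] {f : M → ℝ}
    (hf : ContMDiff (𝓡 n) 𝓘(ℝ, ℝ) ∞ f) {x y : M}
    (hx : x ∈ (chartAt (EuclideanSpace ℝ (Fin n)) y).source) (v : TangentSpace (𝓡 n) x) :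
    mfderiv (𝓡 n) 𝓘(ℝ, ℝ) f x v = fderiv ℝ (localRep n f y) (extChartAt (𝓡 n) y x)
      ((trivializationAt (EuclideanSpace ℝ (Fin n)) (fun x : M ↦ TangentSpace (𝓡 n) x)
        y).continuousLinearMapAt ℝ x v) := by
  have : IsManifold (𝓡 n) 1 M := .of_le (n := ∞) (by norm_cast)
  have hx' : x ∈ (extChartAt (𝓡 n) y).source := by simpa using hx
  have hd : DifferentiableAt ℝ (localRep n f y) (extChartAt (𝓡 n) y x) :=
    (contDiffAt_localRep hf ((extChartAt (𝓡 n) y).map_source hx')).differentiableAt (by simp)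
  have heq : f =ᶠ[𝓝 x] localRep n f y ∘ extChartAt (𝓡 n) y := by
    filter_upwards [(isOpen_extChartAt_source y).mem_nhds hx'] with z hz
    simp only [localRep, Function.comp_apply, (extChartAt (𝓡 n) y).left_inv hz]
  rw [heq.mfderiv_eq, TangentBundle.continuousLinearMapAt_trivializationAt hx,
    mfderiv_comp x hd.mdifferentiableAt (mdifferentiableAt_extChartAt hx), mfderiv_eq_fderiv]
  rfl

/-- In a trivialization the gradient solves `G x u = D x`, with `G` the Gram form of the metric and
`D` the differential of `f`. Inversion of operators is smooth, so `u` inherits the regularity of `G`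
and `D`. -/
theorem contMDiff_grad [IsManifold (𝓡 n) ∞ M]
    [RiemannianBundle (fun x : M ↦ TangentSpace (𝓡 n) x)]
    [IsContMDiffRiemannianBundle (𝓡 n) ∞ (EuclideanSpace ℝ (Fin n))
      (fun x : M ↦ TangentSpace (𝓡 n) x)] {f : M → ℝ} (hf : ContMDiff (𝓡 n) 𝓘(ℝ, ℝ) ∞ f) :
    ContMDiff (𝓡 n) (𝓡 n).tangent 1 (fun x ↦ (⟨x, grad n f x⟩ : TangentBundle (𝓡 n) M)) := by
  intro y
  let E := EuclideanSpace ℝ (Fin n)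
  obtain ⟨g, hg, hg'⟩ := IsContMDiffRiemannianBundle.exists_contMDiff (IB := 𝓡 n) (n := ∞) (F := E)
    (E := fun x : M ↦ TangentSpace (𝓡 n) x)
  have hg1 := (hg y).of_le (m := 1) (by norm_cast)
  rw [contMDiffAt_hom_bundle] at hg1
  have hG := hg1.2
  dsimp only at hG
  let G : M → E →L[ℝ] E →L[ℝ] ℝ := fun x ↦ ContinuousLinearMap.inCoordinates E
    (fun x : M ↦ TangentSpace (𝓡 n) x) (E →L[ℝ] ℝ) (fun x : M ↦ TangentSpace (𝓡 n) x →L[ℝ] ℝ)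
    y x y x (g x)
  let D : M → E →L[ℝ] ℝ := fun x ↦ fderiv ℝ (localRep n f y) (extChartAt (𝓡 n) y x)
  have hD : ContMDiffAt (𝓡 n) 𝓘(ℝ, E →L[ℝ] ℝ) 1 D y := by
    have h1 : ContDiffAt ℝ 1 (fderiv ℝ (localRep n f y)) (extChartAt (𝓡 n) y y) :=
      (contDiffAt_localRep hf (mem_extChartAt_target y)).fderiv_right (m := 1) (by norm_cast)
    exact h1.contMDiffAt.comp y (contMDiffAt_extChartAt.of_le (by norm_cast))
  set e := trivializationAt E (fun x : M ↦ TangentSpace (𝓡 n) x) y with he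
  have hGe : ∀ x ∈ e.baseSet, ∀ v w, G x v w = inner ℝ (e.symm x v) (e.symm x w) := by
    intro x hx v w
    simp only [G]
    rw [inCoordinates_apply_eq₂ hx hx (mem_univ _), hg']
    simp [he]
  -- Positive definiteness gives injectivity, and the dimensions agree.
  have hGinv : ∀ x ∈ e.baseSet, (G x).IsInvertible := by
    intro x hx
    have hinj : Function.Injective (G x) := by
      refine (injective_iff_map_eq_zero _).2 fun v hv ↦ ?_
      have h1 : inner ℝ (e.symm x v) (e.symm x v) = (0 : ℝ) := by
        rw [← hGe x hx, hv]; rfl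
      have h2 : e.symm x v = 0 := inner_self_eq_zero.1 h1
      have h3 := (e.continuousLinearEquivAt ℝ x hx).symm.map_eq_zero_iff (x := v)
      exact h3.1 h2
    have hdim : Module.finrank ℝ E = Module.finrank ℝ (E →L[ℝ] ℝ) :=
      (InnerProductSpace.toDual ℝ E).toLinearEquiv.finrank_eq
    refine ⟨(LinearEquiv.ofInjectiveOfFinrankEq (G x : E →ₗ[ℝ] E →L[ℝ] ℝ) hinj hdim).toContinuousLinearEquiv, ?_⟩
    ext; rfl
  have hsol : ∀ x ∈ e.baseSet, G x (e ⟨x, grad n f x⟩).2 = D x := by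
    intro x hx
    ext w
    rw [hGe x hx, e.symm_apply_apply_mk hx, inner_grad,
      mfderiv_apply_eq_fderiv_localRep hf (by simpa [he] using hx)]
    congr 1
    have h1 := Trivialization.continuousLinearMapAt_symmL (R := ℝ) e hx w
    rw [Trivialization.symmL_apply _ hx] at h1
    exact h1
  refine contMDiffAt_totalSpace.2 ⟨contMDiffAt_id, ?_⟩
  have hy : y ∈ e.baseSet := mem_baseSet_trivializationAt _ _ y
  have hcomp : ContMDiffAt (𝓡 n) 𝓘(ℝ, E) 1 (fun x ↦ (G x).inverse (D x)) y :=
    ((hGinv y hy).contDiffAt_map_inverse.contMDiffAt.comp y hG).clm_apply hD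
  refine hcomp.congr_of_eventuallyEq ?_
  filter_upwards [e.open_baseSet.mem_nhds hy] with x hx
  rw [← hsol x hx]
  exact ((hGinv x hx).inverse_apply_eq.2 rfl).symm

end Gradient

/-! ### Local flows of a `C¹` vector field -/

section LocalFlow

variable {E : Type*} [NormedAddCommGroup E] [NormedSpace ℝ E]
  {M : Type*} [TopologicalSpace M] [ChartedSpace E M] [IsManifold 𝓘(ℝ, E) 1 M]
  {v : (x : M) → TangentSpace 𝓘(ℝ, E) x}

theorem hasMFDerivAt_extChartAt_symm_comp {y : M} {α : ℝ → E} {t : ℝ}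
    (ht : α t ∈ (extChartAt 𝓘(ℝ, E) y).target)
    (hα : HasDerivAt α ((trivializationAt E (fun x : M ↦ TangentSpace 𝓘(ℝ, E) x) y
      ⟨(extChartAt 𝓘(ℝ, E) y).symm (α t), v ((extChartAt 𝓘(ℝ, E) y).symm (α t))⟩).2) t) :
    HasMFDerivAt 𝓘(ℝ, ℝ) 𝓘(ℝ, E) ((extChartAt 𝓘(ℝ, E) y).symm ∘ α) t
      ((1 : ℝ →L[ℝ] ℝ).smulRight (v (((extChartAt 𝓘(ℝ, E) y).symm ∘ α) t))) := by
  set φ := extChartAt 𝓘(ℝ, E) y with hφ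
  set x := φ.symm (α t) with hx
  have hxs : x ∈ (chartAt E y).source := by
    rw [← extChartAt_source 𝓘(ℝ, E)]; exact φ.map_target ht
  have hφx : φ x = α t := φ.right_inv ht
  have h1 : MDifferentiableAt 𝓘(ℝ, E) 𝓘(ℝ, E) φ.symm (α t) :=
    (mdifferentiableOn_extChartAt_symm (α t) ht).mdifferentiableAt
      ((isOpen_extChartAt_target y).mem_nhds ht)
  have h2 := h1.hasMFDerivAt.comp t hα.hasFDerivAt.hasMFDerivAt
  refine h2.congr_mfderiv ?_
  ext
  have h3 := TangentBundle.symmL_trivializationAt (I := 𝓘(ℝ, E)) (𝕜 := ℝ) hxs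
  have hxb : x ∈ (trivializationAt E (fun x : M ↦ TangentSpace 𝓘(ℝ, E) x) y).baseSet := by
    simpa using hxs
  rw [← hφ, hφx, modelWithCornersSelf_coe, range_id, mfderivWithin_univ] at h3
  rw [← h3]
  change (trivializationAt E (fun x : M ↦ TangentSpace 𝓘(ℝ, E) x) y).symmL ℝ x ((1 : ℝ) •
    (trivializationAt E (fun x : M ↦ TangentSpace 𝓘(ℝ, E) x) y ⟨x, v x⟩).2) = (1 : ℝ) • v x
  rw [one_smul, one_smul, Trivialization.symmL_apply _ hxb]
  exact (trivializationAt E (fun x : M ↦ TangentSpace 𝓘(ℝ, E) x) y).symm_apply_apply_mk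
    hxb (v x)

/-- Picard–Lindelöf in a chart, with continuous dependence on the initial value. Time and
neighbourhood are shrunk so that solutions stay in the chart target. -/
theorem exists_local_flow [CompleteSpace E] {y : M}
    (hv : ContMDiffAt 𝓘(ℝ, E) 𝓘(ℝ, E).tangent 1 (fun x ↦ (⟨x, v x⟩ : TangentBundle 𝓘(ℝ, E) M)) y) :
    ∃ U ∈ 𝓝 y, ∃ ε > (0 : ℝ), ∃ γ : M → ℝ → M,
      (∀ x ∈ U, γ x 0 = x ∧ IsMIntegralCurveOn (γ x) v (Ioo (-ε) ε)) ∧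
      ∀ t ∈ Ioo (-ε) ε, ContinuousOn (fun x ↦ γ x t) U := by
  set φ := extChartAt 𝓘(ℝ, E) y with hφ
  let w : E → E := fun z ↦ (trivializationAt E (fun x : M ↦ TangentSpace 𝓘(ℝ, E) x) y
    ⟨φ.symm z, v (φ.symm z)⟩).2
  have hw : ContDiffAt ℝ 1 w (φ y) := by
    have h1 : ContMDiffAt 𝓘(ℝ, E) 𝓘(ℝ, E) 1 (fun x ↦ (trivializationAt E
      (fun x : M ↦ TangentSpace 𝓘(ℝ, E) x) y ⟨x, v x⟩).2) y := (contMDiffAt_totalSpace.1 hv).2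
    have h2 : ContMDiffAt 𝓘(ℝ, E) 𝓘(ℝ, E) 1 φ.symm (φ y) :=
      (contMDiffOn_extChartAt_symm y).contMDiffAt (extChartAt_target_mem_nhds y)
    exact (h1.comp_of_eq h2 (extChartAt_to_inv y)).contDiffAt
  obtain ⟨ε, hε, a, r, L, K, hr, hpl⟩ := IsPicardLindelof.of_contDiffAt_one hw
  obtain ⟨α, hα, hαc⟩ := (hpl 0).exists_forall_mem_closedBall_eq_hasDerivWithinAt_continuousOn
  simp only [zero_sub, zero_add] at hα hαc
  have hr' : (0 : ℝ) < r := hr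
  have hα0 : α (φ y, 0) = φ y := (hα _ (Metric.mem_closedBall_self hr'.le)).1
  have hcont : ContinuousAt α (φ y, 0) := hαc.continuousAt
    (prod_mem_nhds (Metric.closedBall_mem_nhds _ hr') (Icc_mem_nhds (by linarith) hε))
  have hev : ∀ᶠ z in 𝓝 (φ y, (0 : ℝ)), α z ∈ φ.target :=
    hcont (by rw [hα0]; exact extChartAt_target_mem_nhds y)
  obtain ⟨A, hA, B, hB, hAB⟩ := mem_nhds_prod_iff.1 hev
  obtain ⟨δ, hδ, hδB⟩ := Metric.mem_nhds_iff.1 hB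
  rw [Real.ball_eq_Ioo, zero_sub, zero_add] at hδB
  refine ⟨φ.source ∩ φ ⁻¹' (A ∩ Metric.closedBall (φ y) r), ?_, min ε δ, lt_min hε hδ,
    fun x t ↦ φ.symm (α (φ x, t)), ?_, ?_⟩
  · exact inter_mem (extChartAt_source_mem_nhds y)
      (continuousAt_extChartAt y (inter_mem hA (Metric.closedBall_mem_nhds _ hr')))
  · rintro x ⟨hx, hxA, hxr⟩
    refine ⟨by simp only [(hα _ hxr).1, φ.left_inv hx], fun t ht ↦ ?_⟩
    have ht1 : t ∈ Ioo (-ε) ε := ⟨by linarith [ht.1, min_le_left ε δ],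
      by linarith [ht.2, min_le_left ε δ]⟩
    have ht2 : t ∈ Ioo (-δ) δ := ⟨by linarith [ht.1, min_le_right ε δ],
      by linarith [ht.2, min_le_right ε δ]⟩
    have h1 := ((hα _ hxr).2 t (Ioo_subset_Icc_self ht1)).hasDerivAt (Icc_mem_nhds ht1.1 ht1.2)
    exact (hasMFDerivAt_extChartAt_symm_comp (α := fun t ↦ α (φ x, t))
      (hAB ⟨hxA, hδB ht2⟩) h1).hasMFDerivWithinAt
  · rintro t ht
    have ht1 : t ∈ Icc (-ε) ε := ⟨by linarith [ht.1, min_le_left ε δ],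
      by linarith [ht.2, min_le_left ε δ]⟩
    have ht2 : t ∈ Ioo (-δ) δ := ⟨by linarith [ht.1, min_le_right ε δ],
      by linarith [ht.2, min_le_right ε δ]⟩
    have h1 : ContinuousOn (fun x ↦ (φ x, t)) (φ.source ∩ φ ⁻¹' (A ∩ Metric.closedBall (φ y) r)) :=
      ((continuousOn_extChartAt y).mono inter_subset_left).prodMk continuousOn_const
    exact (continuousOn_extChartAt_symm y).comp (hαc.comp h1 fun x hx ↦ ⟨hx.2.2, ht1⟩)
      fun x hx ↦ hAB ⟨hx.2.1, hδB ht2⟩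

end LocalFlow

/-! ### Global flows on a compact manifold -/

section Flow

section GlobalFlow

variable {E : Type*} [NormedAddCommGroup E] [NormedSpace ℝ E]
  {M : Type*} [TopologicalSpace M] [ChartedSpace E M] [IsManifold 𝓘(ℝ, E) 1 M]
  {v : (x : M) → TangentSpace 𝓘(ℝ, E) x}

theorem exists_local_flow_uniform_time [CompleteSpace E] [CompactSpace M]
    (hv : ContMDiff 𝓘(ℝ, E) 𝓘(ℝ, E).tangent 1 (fun x ↦ (⟨x, v x⟩ : TangentBundle 𝓘(ℝ, E) M))) :
    ∃ ε > (0 : ℝ), ∀ y : M, ∃ U ∈ 𝓝 y, ∃ γ : M → ℝ → M,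
      (∀ x ∈ U, γ x 0 = x ∧ IsMIntegralCurveOn (γ x) v (Ioo (-ε) ε)) ∧
      ∀ t ∈ Ioo (-ε) ε, ContinuousOn (fun x ↦ γ x t) U := by
  suffices ∃ ε > (0 : ℝ), ∀ y ∈ (univ : Set M), ∃ U ∈ 𝓝 y, ∃ γ : M → ℝ → M,
      (∀ x ∈ U, γ x 0 = x ∧ IsMIntegralCurveOn (γ x) v (Ioo (-ε) ε)) ∧
      ∀ t ∈ Ioo (-ε) ε, ContinuousOn (fun x ↦ γ x t) U by simpa using this
  refine isCompact_univ.induction_on (p := fun s ↦ ∃ ε > (0 : ℝ), ∀ y ∈ s, ∃ U ∈ 𝓝 y,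
      ∃ γ : M → ℝ → M, (∀ x ∈ U, γ x 0 = x ∧ IsMIntegralCurveOn (γ x) v (Ioo (-ε) ε)) ∧
      ∀ t ∈ Ioo (-ε) ε, ContinuousOn (fun x ↦ γ x t) U) ⟨1, one_pos, by simp⟩ ?_ ?_ ?_
  · rintro s t hst ⟨ε, hε, h⟩
    exact ⟨ε, hε, fun y hy ↦ h y (hst hy)⟩
  · rintro s t ⟨ε, hε, h⟩ ⟨δ, hδ, h'⟩
    have h1 : Ioo (-(min ε δ)) (min ε δ) ⊆ Ioo (-ε) ε :=
      Ioo_subset_Ioo (neg_le_neg (min_le_left _ _)) (min_le_left _ _)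
    have h2 : Ioo (-(min ε δ)) (min ε δ) ⊆ Ioo (-δ) δ :=
      Ioo_subset_Ioo (neg_le_neg (min_le_right _ _)) (min_le_right _ _)
    refine ⟨min ε δ, lt_min hε hδ, ?_⟩
    rintro y (hy | hy)
    · obtain ⟨U, hU, γ, hγ, hγ'⟩ := h y hy
      exact ⟨U, hU, γ, fun x hx ↦ ⟨(hγ x hx).1, (hγ x hx).2.mono h1⟩, fun t ht ↦ hγ' t (h1 ht)⟩
    · obtain ⟨U, hU, γ, hγ, hγ'⟩ := h' y hy
      exact ⟨U, hU, γ, fun x hx ↦ ⟨(hγ x hx).1, (hγ x hx).2.mono h2⟩, fun t ht ↦ hγ' t (h2 ht)⟩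
  · intro y _
    obtain ⟨U, hU, ε, hε, γ, hγ⟩ := exists_local_flow (hv y)
    exact ⟨interior U, mem_nhdsWithin_of_mem_nhds (interior_mem_nhds.2 hU), ε, hε,
      fun z hz ↦ ⟨U, mem_interior_iff_mem_nhds.1 hz, γ, hγ⟩⟩

theorem exists_isMIntegralCurve [CompleteSpace E] [CompactSpace M] [T2Space M]
    (hv : ContMDiff 𝓘(ℝ, E) 𝓘(ℝ, E).tangent 1 (fun x ↦ (⟨x, v x⟩ : TangentBundle 𝓘(ℝ, E) M)))
    (x : M) : ∃ γ : ℝ → M, γ 0 = x ∧ IsMIntegralCurve γ v := by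
  obtain ⟨ε, hε, h⟩ := exists_local_flow_uniform_time hv
  refine exists_isMIntegralCurve_of_isMIntegralCurveOn hv hε (fun y ↦ ?_) x
  obtain ⟨U, hU, γ, hγ, -⟩ := h y
  exact ⟨γ y, hγ y (mem_of_mem_nhds hU)⟩

variable [T2Space M] {Φ : ℝ → M → M}

theorem flow_add
    (hv : ContMDiff 𝓘(ℝ, E) 𝓘(ℝ, E).tangent 1 (fun x ↦ (⟨x, v x⟩ : TangentBundle 𝓘(ℝ, E) M)))
    (hΦ0 : ∀ x, Φ 0 x = x) (hΦ : ∀ x, IsMIntegralCurve (fun t ↦ Φ t x) v) (s t : ℝ) (x : M) :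
    Φ (s + t) x = Φ s (Φ t x) :=
  congrFun (isMIntegralCurve_Ioo_eq_of_contMDiff_boundaryless (t₀ := 0) hv ((hΦ x).comp_add t)
    (hΦ (Φ t x)) (by simp [hΦ0])) s

/-- For short times uniqueness identifies `Φ` with the continuous local flows; a general time `t` is
reached by iterating `Φ (t / N)`. -/
theorem continuous_flow [CompleteSpace E] [CompactSpace M]
    (hv : ContMDiff 𝓘(ℝ, E) 𝓘(ℝ, E).tangent 1 (fun x ↦ (⟨x, v x⟩ : TangentBundle 𝓘(ℝ, E) M)))
    (hΦ0 : ∀ x, Φ 0 x = x) (hΦ : ∀ x, IsMIntegralCurve (fun t ↦ Φ t x) v) (t : ℝ) :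
    Continuous (Φ t) := by
  obtain ⟨ε, hε, h⟩ := exists_local_flow_uniform_time hv
  have hloc : ∀ s ∈ Ioo (-ε) ε, Continuous (Φ s) := by
    intro s hs
    refine continuous_iff_continuousAt.2 fun y ↦ ?_
    obtain ⟨U, hU, γ, hγ, hγ'⟩ := h y
    refine ((hγ' s hs).continuousAt hU).congr ?_
    filter_upwards [hU] with x hx
    exact isMIntegralCurveOn_Ioo_eqOn_of_contMDiff_boundaryless (t₀ := 0) ⟨by linarith, hε⟩ hv
      (hγ x hx).2 ((hΦ x).isMIntegralCurveOn _) (by rw [(hγ x hx).1, hΦ0]) hs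
  obtain ⟨N, hN⟩ := exists_nat_gt (|t| / ε)
  have hN0 : (0 : ℝ) < N := lt_of_le_of_lt (by positivity) hN
  have hs : Continuous (Φ (t / N)) := by
    refine hloc _ (abs_lt.1 ?_)
    rw [abs_div, abs_of_pos hN0, div_lt_iff₀ hN0]
    rwa [div_lt_iff₀ hε, mul_comm] at hN
  have hmul : ∀ m : ℕ, Continuous (Φ (m * (t / N))) := by
    intro m
    induction m with
    | zero => simpa [funext hΦ0] using! continuous_id
    | succ m ih =>
      have : Φ ((m + 1 : ℕ) * (t / N)) = Φ (m * (t / N)) ∘ Φ (t / N) := by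
        ext x
        rw [Function.comp_apply, ← flow_add hv hΦ0 hΦ]
        push_cast
        ring_nf
      rw [this]
      exact ih.comp hs
  simpa [mul_div_cancel₀ _ hN0.ne'] using hmul N

end GlobalFlow

/-! ### Gradient flows and their rest points -/

variable {n : ℕ} {M : Type*} [TopologicalSpace M] [ChartedSpace (EuclideanSpace ℝ (Fin n)) M]
  [RiemannianBundle (fun x : M ↦ TangentSpace (𝓡 n) x)] {f g : M → ℝ}

theorem hasDerivAt_comp_isMIntegralCurve (hf : ContMDiff (𝓡 n) 𝓘(ℝ, ℝ) ∞ f) {γ : ℝ → M}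
    (hγ : IsMIntegralCurve γ (grad n g)) (t : ℝ) :
    HasDerivAt (fun t ↦ f (γ t)) (inner ℝ (grad n f (γ t)) (grad n g (γ t))) t := by
  let L : ℝ →L[ℝ] ℝ := (mfderiv (𝓡 n) 𝓘(ℝ, ℝ) f (γ t)).comp
    ((1 : ℝ →L[ℝ] ℝ).smulRight (grad n g (γ t)))
  have h1 : HasFDerivAt (fun t ↦ f (γ t)) L t :=
    (((hf (γ t)).mdifferentiableAt (by simp)).hasMFDerivAt.comp t (hγ t)).hasFDerivAt
  refine h1.hasDerivAt.congr_deriv ?_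
  rw [inner_grad]
  change mfderiv (𝓡 n) 𝓘(ℝ, ℝ) f (γ t) ((1 : ℝ) • grad n g (γ t)) = _
  rw [one_smul]

theorem grad_eq_zero_iff {x : M} : grad n f x = 0 ↔ x ∈ criticalSet n f := by
  constructor
  · intro h
    ext v
    rw [← inner_grad, h, inner_zero_left]
    rfl
  · intro h
    have h' : mfderiv (𝓡 n) 𝓘(ℝ, ℝ) f x = 0 := h
    rw [← inner_self_eq_zero (𝕜 := ℝ), inner_grad, h']
    rfl

variable [IsManifold (𝓡 n) ∞ M] [IsContMDiffRiemannianBundle (𝓡 n) ∞ (EuclideanSpace ℝ (Fin n))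
      (fun x : M ↦ TangentSpace (𝓡 n) x)] [T2Space M] [CompactSpace M]

theorem gradFlow_spec (hf : ContMDiff (𝓡 n) 𝓘(ℝ, ℝ) ∞ f) (x : M) :
    gradFlow n f 0 x = x ∧ IsMIntegralCurve (fun t ↦ gradFlow n f t x) (grad n f) := by
  have : IsManifold (𝓡 n) 1 M := .of_le (n := ∞) (by norm_cast)
  have h := exists_isMIntegralCurve (contMDiff_grad hf) x
  simp only [gradFlow, dif_pos h]
  exact h.choose_spec

theorem gradFlow_add (hf : ContMDiff (𝓡 n) 𝓘(ℝ, ℝ) ∞ f) (s t : ℝ) (x : M) :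
    gradFlow n f (s + t) x = gradFlow n f s (gradFlow n f t x) := by
  have : IsManifold (𝓡 n) 1 M := .of_le (n := ∞) (by norm_cast)
  exact flow_add (contMDiff_grad hf) (fun x ↦ (gradFlow_spec hf x).1)
    (fun x ↦ (gradFlow_spec hf x).2) s t x

theorem continuous_gradFlow (hf : ContMDiff (𝓡 n) 𝓘(ℝ, ℝ) ∞ f) (t : ℝ) :
    Continuous (gradFlow n f t : M → M) := by
  have : IsManifold (𝓡 n) 1 M := .of_le (n := ∞) (by norm_cast)
  exact continuous_flow (contMDiff_grad hf) (fun x ↦ (gradFlow_spec hf x).1)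
    (fun x ↦ (gradFlow_spec hf x).2) t

theorem continuous_gradFlow_left (hf : ContMDiff (𝓡 n) 𝓘(ℝ, ℝ) ∞ f) (x : M) :
    Continuous fun t ↦ gradFlow n f t x :=
  (gradFlow_spec hf x).2.continuous

theorem hasDerivAt_comp_gradFlow (hf : ContMDiff (𝓡 n) 𝓘(ℝ, ℝ) ∞ f)
    (hg : ContMDiff (𝓡 n) 𝓘(ℝ, ℝ) ∞ g) (x : M) (t : ℝ) :
    HasDerivAt (fun t ↦ f (gradFlow n g t x))
      (inner ℝ (grad n f (gradFlow n g t x)) (grad n g (gradFlow n g t x))) t :=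
  hasDerivAt_comp_isMIntegralCurve hf (gradFlow_spec hg x).2 t

theorem forall_gradFlow_eq_iff (hf : ContMDiff (𝓡 n) 𝓘(ℝ, ℝ) ∞ f) {x : M} :
    (∀ t, gradFlow n f t x = x) ↔ x ∈ criticalSet n f := by
  have : IsManifold (𝓡 n) 1 M := .of_le (n := ∞) (by norm_cast)
  constructor
  · intro h
    have hγ : IsMIntegralCurve (fun _ ↦ x) (grad n f) := by
      simpa only [h] using (gradFlow_spec hf x).2
    have h1 := hasDerivAt_comp_isMIntegralCurve hf hγ 0
    have h2 : inner ℝ (grad n f x) (grad n f x) = (0 : ℝ) :=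
      h1.unique (hasDerivAt_const (0 : ℝ) (f x))
    exact grad_eq_zero_iff.1 (inner_self_eq_zero.1 h2)
  · intro h t
    exact congrFun (isMIntegralCurve_Ioo_eq_of_contMDiff_boundaryless (t₀ := 0) (contMDiff_grad hf)
      (gradFlow_spec hf x).2 (isMIntegralCurve_const (grad_eq_zero_iff.2 h))
      (gradFlow_spec hf x).1) t

end Flow

/-! ### Comparison of nearby gradients -/

section Comparison

theorem eventually_norm_sub_le_of_ne_zero {E F T : Type*} [NormedAddCommGroup E]
    [NormedAddCommGroup F] [TopologicalSpace T] {D : T → E → F}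
    {s : T} {a : E} (hc : ContinuousAt (fun z : T × E ↦ D z.1 z.2) (s, a)) (ha : D s a ≠ 0)
    {ε : ℝ} (hε : 0 < ε) :
    ∀ᶠ z : T × E in 𝓝 (s, a), ‖D z.1 z.2 - D s z.2‖ ≤ ε * ‖D s z.2‖ := by
  have h1 : ContinuousAt (fun z : T × E ↦ D s z.2) (s, a) :=
    hc.comp_of_eq (f := fun z : T × E ↦ (s, z.2)) (by fun_prop) rfl
  have h2 : ContinuousAt (fun z : T × E ↦ ε * ‖D s z.2‖ - ‖D z.1 z.2 - D s z.2‖) (s, a) :=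
    (h1.norm.const_mul ε).sub (hc.sub h1).norm
  have h3 : 0 < ε * ‖D s a‖ - ‖D s a - D s a‖ := by
    have := norm_pos_iff.2 ha
    simp only [sub_self, norm_zero, sub_zero]; positivity
  filter_upwards [h2.eventually (lt_mem_nhds h3)] with z hz
  linarith

section Estimate

variable {E : Type*} [NormedAddCommGroup E] [NormedSpace ℝ E]
  {F : Type*} [NormedAddCommGroup F] [NormedSpace ℝ F]

theorem continuousAt_fderiv_of_iteratedFDeriv {Z : Type*} [TopologicalSpace Z] {f : Z → E → F}
    {a : Z → E} {z : Z} (h : ContinuousAt (fun z ↦ iteratedFDeriv ℝ 1 (f z) (a z)) z) :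
    ContinuousAt (fun z ↦ fderiv ℝ (f z) (a z)) z := by
  have h1 : (fun z ↦ fderiv ℝ (f z) (a z)) = fun z ↦ continuousMultilinearCurryFin0 ℝ E (E →L[ℝ] F)
      (continuousMultilinearCurryRightEquiv' ℝ 0 E F (iteratedFDeriv ℝ 1 (f z) (a z))) := by
    funext z
    simp only [iteratedFDeriv_succ_eq_comp_right, iteratedFDeriv_zero_eq_comp, Function.comp_apply,
      LinearIsometryEquiv.apply_symm_apply]
  rw [h1]
  exact ((LinearIsometryEquiv.continuous _).comp (LinearIsometryEquiv.continuous _)).continuousAt.comp h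

theorem continuousAt_fderiv_fderiv_of_iteratedFDeriv {Z : Type*} [TopologicalSpace Z]
    {f : Z → E → F} {a : Z → E} {z : Z}
    (h : ContinuousAt (fun z ↦ iteratedFDeriv ℝ 2 (f z) (a z)) z) :
    ContinuousAt (fun z ↦ fderiv ℝ (fderiv ℝ (f z)) (a z)) z := by
  refine continuousAt_fderiv_of_iteratedFDeriv (f := fun z ↦ fderiv ℝ (f z)) ?_
  have h1 : (fun z ↦ iteratedFDeriv ℝ 1 (fderiv ℝ (f z)) (a z)) = fun z ↦
      continuousMultilinearCurryRightEquiv' ℝ 1 E F (iteratedFDeriv ℝ 2 (f z) (a z)) := by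
    funext z
    rw [iteratedFDeriv_succ_eq_comp_right (n := 1) (f := f z), Function.comp_apply,
      LinearIsometryEquiv.apply_symm_apply]
  rw [h1]
  exact (LinearIsometryEquiv.continuous _).continuousAt.comp h

/-- A family of maps which is `C¹`-continuous in the parameter and has a common nondegenerate zero
varies little compared with the size of its values. -/
theorem eventually_norm_sub_le_of_common_zero [FiniteDimensional ℝ E] {T : Type*}
    [TopologicalSpace T] {D : T → E → F}
    {s : T} {a : E} {Ω : Set E} (hΩ : Ω ∈ 𝓝 a) (hd : ∀ t, ∀ z ∈ Ω, DifferentiableAt ℝ (D t) z)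
    (hc : ContinuousAt (fun z : T × E ↦ fderiv ℝ (D z.1) z.2) (s, a))
    (hzero : ∀ t, D t a = 0) (hinj : ∀ v, fderiv ℝ (D s) a v = 0 → v = 0) {ε : ℝ} (hε : 0 < ε) :
    ∀ᶠ z : T × E in 𝓝 (s, a), ‖D z.1 z.2 - D s z.2‖ ≤ ε * ‖D s z.2‖ := by
  set A := fderiv ℝ (D s) a with hA
  obtain ⟨K, hK, hAK⟩ := (A : E →ₗ[ℝ] F).exists_antilipschitzWith
    (LinearMap.ker_eq_bot'.2 hinj)
  have hK' : (0 : ℝ) < K := hK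
  have hA' : ∀ v, ‖v‖ ≤ K * ‖A v‖ := fun v ↦ by
    simpa using hAK.le_mul_dist v 0
  -- The bound `η * K ≤ 1 / 2` absorbs the linearization error and gives `‖z - a‖ ≤ 2 * K * ‖D s
  -- z‖`; the bound `4 * η * K ≤ ε` then yields the claim.
  set η : ℝ := min (1 / (2 * K)) (ε / (4 * K)) with hη
  have hη0 : 0 < η := lt_min (by positivity) (by positivity)
  have hη1 : η * (2 * K) ≤ 1 := (le_div_iff₀ (by positivity)).1 (min_le_left _ _)
  have hη2 : η * (4 * K) ≤ ε := (le_div_iff₀ (by positivity)).1 (min_le_right _ _)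
  have h1 : ∀ᶠ z : T × E in 𝓝 (s, a), ‖fderiv ℝ (D z.1) z.2 - A‖ ≤ η ∧ z.2 ∈ Ω := by
    refine Eventually.and ?_ (continuousAt_snd.eventually hΩ)
    filter_upwards [hc (Metric.closedBall_mem_nhds A hη0)] with z hz
    simpa [dist_eq_norm] using hz
  obtain ⟨V, hV, B, hB, hVB⟩ := mem_nhds_prod_iff.1 h1
  obtain ⟨r, hr, hrB⟩ := Metric.mem_nhds_iff.1 hB
  -- Mean value inequality from `a`; the common zero removes the term `D t a`.
  have hmv : ∀ t ∈ V, ∀ z ∈ Metric.ball a r, ‖D t z - A (z - a)‖ ≤ η * ‖z - a‖ := by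
    intro t ht z hz
    have := (convex_ball a r).norm_image_sub_le_of_norm_hasFDerivWithin_le' (f := D t)
      (f' := fderiv ℝ (D t)) (φ := A) (C := η)
      (fun x hx ↦ (hd t x (hVB (mk_mem_prod ht (hrB hx))).2).hasFDerivAt.hasFDerivWithinAt)
      (fun x hx ↦ (hVB (mk_mem_prod ht (hrB hx))).1) (Metric.mem_ball_self hr) hz
    simpa [hzero] using this
  filter_upwards [prod_mem_nhds hV (Metric.ball_mem_nhds a hr)] with z hz
  have h2 := hmv z.1 hz.1 z.2 hz.2
  have h3 := hmv s (mem_of_mem_nhds hV) z.2 hz.2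
  have h4 := hA' (z.2 - a)
  have h5 : ‖D z.1 z.2 - D s z.2‖ ≤ 2 * η * ‖z.2 - a‖ := by
    calc ‖D z.1 z.2 - D s z.2‖ = ‖(D z.1 z.2 - A (z.2 - a)) - (D s z.2 - A (z.2 - a))‖ := by
          congr 1; abel
      _ ≤ _ := (norm_sub_le _ _).trans (by linarith)
  have h6 : ‖A (z.2 - a)‖ ≤ ‖D s z.2‖ + η * ‖z.2 - a‖ := by
    calc ‖A (z.2 - a)‖ = ‖D s z.2 - (D s z.2 - A (z.2 - a))‖ := by congr 1; abel
      _ ≤ _ := (norm_sub_le _ _).trans (by linarith)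
  have h7 : ‖z.2 - a‖ ≤ 2 * K * ‖D s z.2‖ := by
    have h8 : K * ‖A (z.2 - a)‖ ≤ K * ‖D s z.2‖ + K * (η * ‖z.2 - a‖) := by
      rw [← mul_add]; gcongr
    have h9 : (η * (2 * K)) * ‖z.2 - a‖ ≤ 1 * ‖z.2 - a‖ := by gcongr
    linarith
  calc ‖D z.1 z.2 - D s z.2‖ ≤ 2 * η * (2 * K * ‖D s z.2‖) := h5.trans (by gcongr)
    _ = (η * (4 * K)) * ‖D s z.2‖ := by ring
    _ ≤ ε * ‖D s z.2‖ := by gcongr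

end Estimate

variable {n : ℕ} {M : Type*} [TopologicalSpace M] [ChartedSpace (EuclideanSpace ℝ (Fin n)) M]
  [IsManifold (𝓡 n) ∞ M]

theorem mem_criticalSet_iff_fderiv_localRep {f : M → ℝ} (hf : ContMDiff (𝓡 n) 𝓘(ℝ, ℝ) ∞ f)
    {x y : M} (hx : x ∈ (chartAt (EuclideanSpace ℝ (Fin n)) y).source) :
    x ∈ criticalSet n f ↔ fderiv ℝ (localRep n f y) (extChartAt (𝓡 n) y x) = 0 := by
  have hb : x ∈ (trivializationAt (EuclideanSpace ℝ (Fin n))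
      (fun x : M ↦ TangentSpace (𝓡 n) x) y).baseSet := by simpa using hx
  constructor
  · intro h
    have h' : mfderiv (𝓡 n) 𝓘(ℝ, ℝ) f x = 0 := h
    ext w
    rw [← Trivialization.continuousLinearMapAt_symmL (R := ℝ) _ hb w,
      ← mfderiv_apply_eq_fderiv_localRep hf hx, h']
    rfl
  · intro h
    change mfderiv (𝓡 n) 𝓘(ℝ, ℝ) f x = 0
    ext v
    have := mfderiv_apply_eq_fderiv_localRep hf hx v
    rw [h] at this
    exact this

/-- An infinite critical set would accumulate at some `y`. The differential in the chart has no
zeros near `y` except possibly `y` itself: by continuity if `y` is not critical, by injectivity of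
the Hessian if it is. -/
theorem IsMorse.finite_criticalSet [CompactSpace M] {f : M → ℝ} (hf : IsMorse n f) :
    (criticalSet n f).Finite := by
  by_contra hinf
  obtain ⟨y, hy⟩ := Set.Infinite.exists_accPt_principal hinf
  have hys : y ∈ (chartAt (EuclideanSpace ℝ (Fin n)) y).source := mem_chart_source _ y
  set φ := extChartAt (𝓡 n) y with hφ
  have hsrc : ∀ᶠ x in 𝓝[≠] y, x ∈ φ.source :=
    eventually_nhdsWithin_of_eventually_nhds (extChartAt_source_mem_nhds y)
  have hφt : Tendsto φ (𝓝[≠] y) (𝓝[≠] (φ y)) := by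
    refine tendsto_nhdsWithin_iff.2 ⟨(continuousAt_extChartAt y).mono_left nhdsWithin_le_nhds, ?_⟩
    filter_upwards [hsrc, self_mem_nhdsWithin] with x hx hxy h
    exact hxy (φ.injOn hx (mem_extChartAt_source y) h)
  have hD : DifferentiableAt ℝ (fderiv ℝ (localRep n f y)) (φ y) :=
    ((contDiffAt_localRep hf.smooth (mem_extChartAt_target y)).fderiv_right (m := 1)
      (by norm_cast)).differentiableAt (by simp)
  have hne : ∀ᶠ z in 𝓝[≠] (φ y), fderiv ℝ (localRep n f y) z ≠ 0 := by
    by_cases h : y ∈ criticalSet n f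
    · refine hD.hasFDerivAt.eventually_ne ?_
      obtain ⟨K, -, hK⟩ := (fderiv ℝ (fderiv ℝ (localRep n f y)) (φ y) :
        EuclideanSpace ℝ (Fin n) →ₗ[ℝ] _).exists_antilipschitzWith
        (LinearMap.ker_eq_bot'.2 fun v hv ↦ hf.nondegenerate y h v fun w ↦ by
          change fderiv ℝ (fderiv ℝ (localRep n f y)) (φ y) v w = 0
          exact congrArg (fun L : EuclideanSpace ℝ (Fin n) →L[ℝ] ℝ ↦ L w) hv)
      exact ⟨K, hK⟩
    · rw [mem_criticalSet_iff_fderiv_localRep hf.smooth hys] at h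
      exact eventually_nhdsWithin_of_eventually_nhds (hD.continuousAt.eventually_ne h)
  rw [accPt_iff_frequently_nhdsNE] at hy
  obtain ⟨x, hx, hx', hxs⟩ := (hy.and_eventually ((hφt.eventually hne).and hsrc)).exists
  exact hx' ((mem_criticalSet_iff_fderiv_localRep hf.smooth (by simpa [hφ] using hxs)).1 hx)

theorem eventually_norm_fderiv_localRep_sub_le {T : Type*} [TopologicalSpace T] {F : T → M → ℝ}
    (hF : IsC2Family n F) (hMorse : ∀ t, IsMorse n (F t))
    (hcrit : ∀ s t, criticalSet n (F s) = criticalSet n (F t)) (s : T) (y : M) {ε : ℝ}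
    (hε : 0 < ε) :
    ∀ᶠ z : T × M in 𝓝 (s, y), ‖fderiv ℝ (localRep n (F z.1) y) (extChartAt (𝓡 n) y z.2) -
        fderiv ℝ (localRep n (F s) y) (extChartAt (𝓡 n) y z.2)‖ ≤
      ε * ‖fderiv ℝ (localRep n (F s) y) (extChartAt (𝓡 n) y z.2)‖ := by
  set φ := extChartAt (𝓡 n) y with hφ
  suffices ∀ᶠ z : T × EuclideanSpace ℝ (Fin n) in 𝓝 (s, φ y),
      ‖fderiv ℝ (localRep n (F z.1) y) z.2 - fderiv ℝ (localRep n (F s) y) z.2‖ ≤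
        ε * ‖fderiv ℝ (localRep n (F s) y) z.2‖ by
    have h1 : ContinuousAt (fun z : T × M ↦ (z.1, φ z.2)) (s, y) :=
      continuousAt_fst.prodMk ((continuousAt_extChartAt y).comp_of_eq continuousAt_snd rfl)
    exact h1.eventually this
  have hcont : ∀ k ≤ 2, ContinuousAt (fun z : T × EuclideanSpace ℝ (Fin n) ↦
      iteratedFDeriv ℝ k (localRep n (F z.1) y) z.2) (s, φ y) := fun k hk ↦
    (hF y k hk).continuousAt (prod_mem_nhds univ_mem (extChartAt_target_mem_nhds y))
  have hy : y ∈ (chartAt (EuclideanSpace ℝ (Fin n)) y).source := mem_chart_source _ y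
  by_cases h : y ∈ criticalSet n (F s)
  · refine eventually_norm_sub_le_of_common_zero (D := fun t ↦ fderiv ℝ (localRep n (F t) y))
      (extChartAt_target_mem_nhds y) (fun t z hz ↦ ?_)
      (continuousAt_fderiv_fderiv_of_iteratedFDeriv (hcont 2 le_rfl)) (fun t ↦ ?_) ?_ hε
    · exact ((contDiffAt_localRep (hMorse t).smooth hz).fderiv_right (m := 1)
        (by norm_cast)).differentiableAt (by simp)
    · exact (mem_criticalSet_iff_fderiv_localRep (hMorse t).smooth hy).1 (hcrit s t ▸ h)
    · intro v hv
      refine (hMorse s).nondegenerate y h v fun w ↦ ?_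
      change fderiv ℝ (fderiv ℝ (localRep n (F s) y)) (φ y) v w = 0
      rw [hv]; rfl
  · exact eventually_norm_sub_le_of_ne_zero (D := fun t ↦ fderiv ℝ (localRep n (F t) y))
      (continuousAt_fderiv_of_iteratedFDeriv (hcont 1 (by norm_num)))
      (fun h' ↦ h ((mem_criticalSet_iff_fderiv_localRep (hMorse s).smooth hy).2 h')) hε

variable [RiemannianBundle (fun x : M ↦ TangentSpace (𝓡 n) x)]
  [IsContMDiffRiemannianBundle (𝓡 n) ∞ (EuclideanSpace ℝ (Fin n))
      (fun x : M ↦ TangentSpace (𝓡 n) x)]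

/-- The chart estimate is moved to the Riemannian norm. The trivialization and its inverse have
norms below `C₁` and `C₂`, so the relative error `1 / (2 * C₁ * C₂)` costs at most `‖X‖ ^ 2 / 2`. -/
theorem eventually_inner_grad_ge {T : Type*} [TopologicalSpace T] {F : T → M → ℝ}
    (hF : IsC2Family n F) (hMorse : ∀ t, IsMorse n (F t))
    (hcrit : ∀ s t, criticalSet n (F s) = criticalSet n (F t)) (s : T) (y : M) :
    ∀ᶠ z : T × M in 𝓝 (s, y),
      ‖grad n (F s) z.2‖ ^ 2 ≤ 2 * inner ℝ (grad n (F z.1) z.2) (grad n (F s) z.2) := by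
  have : IsContinuousRiemannianBundle (EuclideanSpace ℝ (Fin n))
      (fun x : M ↦ TangentSpace (𝓡 n) x) := by
    obtain ⟨g, hg, hg'⟩ := IsContMDiffRiemannianBundle.exists_contMDiff (IB := 𝓡 n) (n := ∞)
      (F := EuclideanSpace ℝ (Fin n)) (E := fun x : M ↦ TangentSpace (𝓡 n) x)
    exact ⟨g, hg.continuous, hg'⟩
  set e := trivializationAt (EuclideanSpace ℝ (Fin n)) (fun x : M ↦ TangentSpace (𝓡 n) x) y with he
  obtain ⟨C₁, hC₁, h₁⟩ := eventually_norm_trivializationAt_lt (EuclideanSpace ℝ (Fin n))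
    (fun x : M ↦ TangentSpace (𝓡 n) x) y
  obtain ⟨C₂, hC₂, h₂⟩ := eventually_norm_symmL_trivializationAt_lt (EuclideanSpace ℝ (Fin n))
    (fun x : M ↦ TangentSpace (𝓡 n) x) y
  have h₃ : ∀ᶠ x in 𝓝 y, x ∈ (chartAt (EuclideanSpace ℝ (Fin n)) y).source :=
    chart_source_mem_nhds _ y
  filter_upwards [continuousAt_snd.eventually h₁, continuousAt_snd.eventually h₂,
    continuousAt_snd.eventually h₃, eventually_norm_fderiv_localRep_sub_le hF hMorse hcrit s y
      (ε := 1 / (2 * C₁ * C₂)) (by positivity)]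
  rintro ⟨t, x⟩ h₁ h₂ h₃ h₄
  dsimp only at h₁ h₂ h₃ h₄ ⊢
  have hb : x ∈ e.baseSet := by simpa [he] using h₃
  set Dt := fderiv ℝ (localRep n (F t) y) (extChartAt (𝓡 n) y x)
  set Ds := fderiv ℝ (localRep n (F s) y) (extChartAt (𝓡 n) y x)
  set X := grad n (F s) x with hX
  have hDs : ‖Ds‖ ≤ ‖X‖ * C₂ := by
    refine ContinuousLinearMap.opNorm_le_bound _ (by positivity) fun w ↦ ?_
    have h5 : Ds w = inner ℝ X (e.symmL ℝ x w) := by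
      rw [inner_grad, mfderiv_apply_eq_fderiv_localRep (hMorse s).smooth h₃,
        Trivialization.continuousLinearMapAt_symmL (R := ℝ) _ hb w]
    rw [h5, mul_assoc]
    refine (norm_inner_le_norm _ _).trans ?_
    gcongr
    exact ((e.symmL ℝ x).le_opNorm w).trans (by gcongr)
  have h6 : inner ℝ (grad n (F t) x) X = Dt (e.continuousLinearMapAt ℝ x X) := by
    rw [inner_grad, mfderiv_apply_eq_fderiv_localRep (hMorse t).smooth h₃]
  have h7 : ‖X‖ ^ 2 = Ds (e.continuousLinearMapAt ℝ x X) := by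
    rw [← real_inner_self_eq_norm_sq]
    nth_rewrite 1 [hX]
    rw [inner_grad, mfderiv_apply_eq_fderiv_localRep (hMorse s).smooth h₃]
  have h8 : ‖(Dt - Ds) (e.continuousLinearMapAt ℝ x X)‖ ≤ ‖X‖ ^ 2 / 2 := by
    calc ‖(Dt - Ds) (e.continuousLinearMapAt ℝ x X)‖
        ≤ ‖Dt - Ds‖ * ‖e.continuousLinearMapAt ℝ x X‖ := (Dt - Ds).le_opNorm _
      _ ≤ (1 / (2 * C₁ * C₂) * (‖X‖ * C₂)) * (C₁ * ‖X‖) := by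
          gcongr
          · exact h₄.trans (by gcongr)
          · exact ((e.continuousLinearMapAt ℝ x).le_opNorm X).trans (by gcongr)
      _ = ‖X‖ ^ 2 / 2 := by field_simp
  have h9 := (abs_le.1 h8).1
  rw [sub_apply] at h9
  linarith

end Comparison

/-! ### Equality of critical sets and of cells -/

section Cells

variable {n : ℕ} {M : Type*} [TopologicalSpace M] [ChartedSpace (EuclideanSpace ℝ (Fin n)) M]
  [IsManifold (𝓡 n) ∞ M] [RiemannianBundle (fun x : M ↦ TangentSpace (𝓡 n) x)]
  [IsContMDiffRiemannianBundle (𝓡 n) ∞ (EuclideanSpace ℝ (Fin n))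
      (fun x : M ↦ TangentSpace (𝓡 n) x)] [T2Space M] [CompactSpace M] {f g : M → ℝ}

/-- The `g`-orbit of a rest point of `f` consists of rest points of `f`; being connected inside a
finite set, it is a single point. -/
theorem criticalSet_subset_of_commute (hf : IsMorse n f) (hg : ContMDiff (𝓡 n) 𝓘(ℝ, ℝ) ∞ g)
    (hcomm : GradFlowsCommute n f g) : criticalSet n f ⊆ criticalSet n g := by
  intro p hp
  refine (forall_gradFlow_eq_iff hg).1 fun t ↦ ?_
  have hmem : range (fun t ↦ gradFlow n g t p) ⊆ criticalSet n f := by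
    rintro _ ⟨t, rfl⟩
    exact (forall_gradFlow_eq_iff hf.smooth).1 fun s ↦ by
      rw [hcomm, (forall_gradFlow_eq_iff hf.smooth).2 hp]
  have hsub : (range fun t ↦ gradFlow n g t p).Subsingleton := not_nontrivial_iff.1 fun h ↦
    (isPreconnected_range (continuous_gradFlow_left hg p)).infinite_of_nontrivial h
      (hf.finite_criticalSet.subset hmem)
  simpa [(gradFlow_spec hg p).1] using hsub (mem_range_self t) (mem_range_self 0)

theorem monotone_comp_gradFlow (hf : ContMDiff (𝓡 n) 𝓘(ℝ, ℝ) ∞ f)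
    (hg : ContMDiff (𝓡 n) 𝓘(ℝ, ℝ) ∞ g)
    (h : ∀ x, (0 : ℝ) ≤ inner ℝ (grad n f x) (grad n g x)) (x : M) :
    Monotone fun t ↦ f (gradFlow n g t x) :=
  monotone_of_hasDerivAt_nonneg (fun t ↦ hasDerivAt_comp_gradFlow hf hg x t) fun _ ↦ h _

theorem inner_grad_eq_zero_of_comp_gradFlow_one_eq (hf : ContMDiff (𝓡 n) 𝓘(ℝ, ℝ) ∞ f)
    (hg : ContMDiff (𝓡 n) 𝓘(ℝ, ℝ) ∞ g)
    (h : ∀ x, (0 : ℝ) ≤ inner ℝ (grad n f x) (grad n g x)) {x : M}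
    (hx : f (gradFlow n g 1 x) = f x) : inner ℝ (grad n f x) (grad n g x) = (0 : ℝ) := by
  have hmono := monotone_comp_gradFlow hf hg h x
  have hconst : EqOn (fun t ↦ f (gradFlow n g t x)) (fun _ ↦ f x) (Icc 0 1) := by
    intro t ht
    refine le_antisymm ((hmono ht.2).trans hx.le) ?_
    have := hmono ht.1
    simpa [(gradFlow_spec hg x).1] using this
  have h0 : (0 : ℝ) ∈ Icc (0 : ℝ) 1 := ⟨le_rfl, zero_le_one⟩
  have h1 : HasDerivWithinAt (fun t ↦ f (gradFlow n g t x)) 0 (Icc 0 1) 0 :=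
    (hasDerivWithinAt_const (0 : ℝ) (Icc 0 1) (f x)).congr hconst (hconst h0)
  have h2 := (uniqueDiffOn_Icc zero_lt_one 0 h0).eq_deriv _
    (hasDerivAt_comp_gradFlow hf hg x 0).hasDerivWithinAt h1
  -- The identity `gradFlow n g 0 x = x` is only propositional and the tangent space depends on the
  -- point, so the point is generalized first.
  have h3 : ∀ y, y = x → inner ℝ (grad n f y) (grad n g y) = (0 : ℝ) →
      inner ℝ (grad n f x) (grad n g x) = (0 : ℝ) := by
    rintro y rfl hy; exact hy
  exact h3 _ (gradFlow_spec hg x).1 h2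

theorem cell_eq_of_inner_grad_ge (hf : IsMorse n f) (hg : IsMorse n g)
    (hfg : GradFlowsCommute n f g) (hC : criticalSet n f = criticalSet n g)
    (h : ∀ x, ‖grad n f x‖ ^ 2 ≤ 2 * inner ℝ (grad n g x) (grad n f x)) {p : M}
    (hp : p ∈ criticalSet n f) : cell n f p = cell n g p := by
  have hge : ∀ x, (0 : ℝ) ≤ inner ℝ (grad n f x) (grad n g x) := fun x ↦ by
    rw [real_inner_comm]; nlinarith [h x, sq_nonneg ‖grad n f x‖]
  have hcrit : ∀ x, inner ℝ (grad n f x) (grad n g x) = (0 : ℝ) → x ∈ criticalSet n f := by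
    intro x hx
    have h1 := h x
    rw [real_inner_comm, hx, mul_zero] at h1
    exact grad_eq_zero_iff.1 (norm_eq_zero.1 (pow_eq_zero_iff two_ne_zero |>.1
      (le_antisymm h1 (sq_nonneg _))))
  have hfix : ∀ {k : M → ℝ}, IsMorse n k → criticalSet n f = criticalSet n k →
      ∀ x ∈ criticalSet n f, ∀ t, gradFlow n k t x = x := fun hk hk' x hx ↦
    (forall_gradFlow_eq_iff hk.smooth).2 (hk' ▸ hx)
  have hself : ∀ x, (0 : ℝ) ≤ inner ℝ (grad n f x) (grad n f x) := fun x ↦ real_inner_self_nonneg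
  have hcrit' : ∀ x, inner ℝ (grad n f x) (grad n f x) = (0 : ℝ) → x ∈ criticalSet n f :=
    fun x hx ↦ grad_eq_zero_iff.1 (inner_self_eq_zero.1 hx)
  ext x
  constructor <;> intro hx
  · exact tendsto_of_commuting (f := f) (continuous_gradFlow hf.smooth)
      (continuous_gradFlow_left hf.smooth) (continuous_gradFlow hg.smooth)
      (fun x ↦ (gradFlow_spec hf.smooth x).1) (fun x ↦ (gradFlow_spec hg.smooth x).1)
      (gradFlow_add hg.smooth) hfg hf.smooth.continuous
      (monotone_comp_gradFlow hf.smooth hf.smooth hself)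
      (monotone_comp_gradFlow hf.smooth hg.smooth hge)
      (fun x hx ↦ hcrit x (inner_grad_eq_zero_of_comp_gradFlow_one_eq hf.smooth hg.smooth hge hx))
      hf.finite_criticalSet (hfix hf rfl) (hfix hg hC) hp hx
  -- The flows exchange roles, but `f` remains the Lyapunov function.
  · exact tendsto_of_commuting (f := f) (continuous_gradFlow hg.smooth)
      (continuous_gradFlow_left hg.smooth) (continuous_gradFlow hf.smooth)
      (fun x ↦ (gradFlow_spec hg.smooth x).1) (fun x ↦ (gradFlow_spec hf.smooth x).1)
      (gradFlow_add hf.smooth) (fun s t x ↦ (hfg t s x).symm) hf.smooth.continuous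
      (monotone_comp_gradFlow hf.smooth hg.smooth hge)
      (monotone_comp_gradFlow hf.smooth hf.smooth hself)
      (fun x hx ↦ hcrit' x (inner_grad_eq_zero_of_comp_gradFlow_one_eq hf.smooth hf.smooth hself hx))
      hf.finite_criticalSet (hfix hg hC) (hfix hf rfl) hp hx

end Cells

end GradientCells

end

theorem theorem2p3 {n : ℕ} {M : Type*} [TopologicalSpace M] [T2Space M] [CompactSpace M]
    [ChartedSpace (EuclideanSpace ℝ (Fin n)) M] [IsManifold (𝓡 n) ∞ M]
    [RiemannianBundle (fun x : M ↦ TangentSpace (𝓡 n) x)]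
    [IsContMDiffRiemannianBundle (𝓡 n) ∞ (EuclideanSpace ℝ (Fin n))
      (fun x : M ↦ TangentSpace (𝓡 n) x)]
    {T : Type*} [TopologicalSpace T] [ConnectedSpace T] (F : T → M → ℝ)
    (hF : GradientCells.IsC2Family n F)
    (hMorse : ∀ t, GradientCells.IsMorse n (F t))
    (hcomm : ∀ s t, GradientCells.GradFlowsCommute n (F s) (F t)) (s t : T) :
    GradientCells.cellDecomposition n (F s) = GradientCells.cellDecomposition n (F t) := by
  have hcrit : ∀ s t, GradientCells.criticalSet n (F s) = GradientCells.criticalSet n (F t) :=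
    fun s t ↦ Subset.antisymm
      (GradientCells.criticalSet_subset_of_commute (hMorse s) (hMorse t).smooth (hcomm s t))
      (GradientCells.criticalSet_subset_of_commute (hMorse t) (hMorse s).smooth (hcomm t s))
  have hloc : IsLocallyConstant fun t ↦ GradientCells.cellDecomposition n (F t) := by
    refine (IsLocallyConstant.iff_eventually_eq _).2 fun s ↦ ?_
    -- Compactness of `M` makes the neighbourhood of `s` independent of the point.
    filter_upwards [isCompact_univ.eventually_forall_of_forall_eventually
      (P := fun t x ↦ ‖GradientCells.grad n (F s) x‖ ^ 2 ≤
        2 * inner ℝ (GradientCells.grad n (F t) x) (GradientCells.grad n (F s) x))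
      (fun y _ ↦ GradientCells.eventually_inner_grad_ge hF hMorse hcrit s y)] with t ht
    rw [GradientCells.cellDecomposition, GradientCells.cellDecomposition, hcrit t s]
    exact image_congr fun p hp ↦ (GradientCells.cell_eq_of_inner_grad_ge (hMorse s) (hMorse t)
      (hcomm s t) (hcrit s t) (fun x ↦ ht x (mem_univ x)) hp).symm
  exact hloc.apply_eq_of_preconnectedSpace s t
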